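/- Let $M^m$ and $B^n$ be smooth Riemannian manifolds with $M$ complete and $B$ compact and connected, and let $\pi : M\to B$ be a smooth surjective map of maximal rank, i.e. $(\pi_*)_x : T_xM\to T_{\pi(x)}B$ is surjective for every $x\in M$. For $x\in M$ let $(VT)_x=\ker(\pi_*)_x$ and let $(HT)_x=(VT)_x^{\perp}\subset T_xM$; the horizontal lift of $w\in T_{\pi(x)}B$ through $x$ is the unique $v\in (HT)_x$ with $(\pi_*)_xv=w$. Assume that there are constants $\alpha\ge 1$ and $\beta>0$ such that, for every $b\in B$, every $x\in F_b:=\pi^{-1}(b)$ and every $w\in T_bB$, the horizontal lift $v$ of $w$ through $x$ satisfies $$\|v\|_M\le \alpha\|w\|_B+\beta .$$ Let $d$ be the Riemannian distance of $M$ (infinite between points of different connected components), and endow each fiber $F_b$ with the restriction of $d$. A map $\varphi : (X,\delta)\to (Y,d')$ between spaces with a (possibly infinite) distance is called a rough isometry if there are constants $A\ge 1$, $C\ge 0$ with $\frac1A\delta(p,q)-C\le d'(\varphi(p),\varphi(q))\le A\,\delta(p,q)+C$ for all $p,q\in X$, and there is $\varepsilon>0$ such that every point of $Y$ is at distance less than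 $\varepsilon$ from $\varphi(X)$. $X$ is roughly isometric to $Y$ if there is a rough isometry $X\to Y$. Then, for each $b\in B$, the inclusion $\iota : F_b\hookrightarrow M$ is a rough isometry. In particular, for each $b\in B$, $M$ is roughly isometric to the product $F_b\times B$ with the distance $\big(d(x,x')^2+d_B(y,y')^2\big)^{1/2}$. -/

import Mathlib

open Bundle Manifold
open scoped ContDiff NNReal ENNReal

noncomputable section

section RoughIsometry

variable {X Y : Type*} [PseudoEMetricSpace X] [PseudoEMetricSpace Y]

/-- A map, not necessarily continuous, between spaces with a (possibly infinite) distance is a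
rough isometry if it distorts distances by at most a multiplicative constant `A ≥ 1` and an
additive constant `C ≥ 0`, and if its image is `ε`-full for some `ε > 0`: every point of the target
is at distance less than `ε` from the image. -/
structure IsRoughIsometry (φ : X → Y) : Prop where
  /-- Coarse bi-Lipschitz control; a difference in `ℝ≥0∞` is truncated at `0`, which does not
  matter here since it is only bounded from above by a distance. -/
  coarse : ∃ A C : ℝ≥0, 1 ≤ A ∧ ∀ p q : X,
    edist p q / A - C ≤ edist (φ p) (φ q) ∧ edist (φ p) (φ q) ≤ A * edist p q + C
  /-- The image is full. -/
  full : ∃ ε : ℝ, 0 < ε ∧ Metric.thickening ε (Set.range φ) = Set.univ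

variable (X Y) in
/-- `X` is roughly isometric to `Y` if there is a rough isometry from `X` to `Y`. -/
def RoughlyIsometric : Prop := ∃ φ : X → Y, IsRoughIsometry φ

end RoughIsometry

/-- In metric spaces, being a rough isometry is the usual condition on real-valued distances. -/
theorem isRoughIsometry_iff_dist {X Y : Type*} [PseudoMetricSpace X] [PseudoMetricSpace Y]
    (φ : X → Y) :
    IsRoughIsometry φ ↔
      (∃ A C : ℝ, 1 ≤ A ∧ 0 ≤ C ∧ ∀ p q : X,
        1 / A * dist p q - C ≤ dist (φ p) (φ q) ∧ dist (φ p) (φ q) ≤ A * dist p q + C) ∧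
      ∃ ε : ℝ, 0 < ε ∧ ∀ y : Y, ∃ x : X, dist y (φ x) < ε := by
  have key : ∀ (A C : ℝ≥0), 1 ≤ A → ∀ p q : X,
      ((edist p q / A - C ≤ edist (φ p) (φ q) ∧ edist (φ p) (φ q) ≤ A * edist p q + C) ↔
      (1 / (A : ℝ) * dist p q - C ≤ dist (φ p) (φ q) ∧
        dist (φ p) (φ q) ≤ A * dist p q + C)) := by
    intro A C hA p q
    have hA0 : A ≠ 0 := (lt_of_lt_of_le one_pos hA).ne'
    simp only [edist_nndist, dist_nndist]
    rw [← ENNReal.coe_div hA0, tsub_le_iff_right, sub_le_iff_le_add]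
    norm_cast
    rw [one_div, inv_mul_eq_div]
  constructor
  · rintro ⟨⟨A, C, hA, h⟩, ε, hε, hf⟩
    refine ⟨⟨A, C, by exact_mod_cast hA, C.2, fun p q => (key A C hA p q).1 (h p q)⟩, ε, hε, ?_⟩
    intro y
    have hy : y ∈ Metric.thickening ε (Set.range φ) := hf ▸ Set.mem_univ y
    obtain ⟨_, ⟨x, rfl⟩, hx⟩ := Metric.mem_thickening_iff.1 hy
    exact ⟨x, hx⟩
  · rintro ⟨⟨A, C, hA, hC, h⟩, ε, hε, hf⟩
    lift A to ℝ≥0 using by linarith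
    lift C to ℝ≥0 using hC
    have hA' : 1 ≤ A := by exact_mod_cast hA
    refine ⟨⟨A, C, hA', fun p q => (key A C hA' p q).2 (h p q)⟩, ε, hε, ?_⟩
    refine Set.eq_univ_of_forall fun y => ?_
    obtain ⟨x, hx⟩ := hf y
    exact Metric.mem_thickening_iff.2 ⟨_, ⟨x, rfl⟩, hx⟩

section HorizontalLift

variable {E H E' H' : Type*} [NormedAddCommGroup E] [NormedSpace ℝ E] [TopologicalSpace H]
  [NormedAddCommGroup E'] [NormedSpace ℝ E'] [TopologicalSpace H']
  (I : ModelWithCorners ℝ E H) (J : ModelWithCorners ℝ E' H')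
  {M B : Type*} [TopologicalSpace M] [ChartedSpace H M] [IsManifold I 1 M]
  [TopologicalSpace B] [ChartedSpace H' B] [IsManifold J 1 B]
  [RiemannianBundle (fun x : M => TangentSpace I x)]

/-- The vertical space of `f` at `x`: the kernel of the derivative of `f`. -/
def verticalSpace (f : M → B) (x : M) : Submodule ℝ (TangentSpace I x) :=
  LinearMap.ker (mfderiv I J f x).toLinearMap

/-- The horizontal space of `f` at `x`: the orthogonal complement of the vertical space with
respect to the Riemannian metric of `M`. -/
def horizontalSpace (f : M → B) (x : M) : Submodule ℝ (TangentSpace I x) :=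
  (verticalSpace I J f x)ᗮ

/-- `v` is the horizontal lift through `x` of the tangent vector `w` at `f x`. -/
def IsHorizontalLift (f : M → B) (x : M) (w : TangentSpace J (f x)) (v : TangentSpace I x) :
    Prop :=
  v ∈ horizontalSpace I J f x ∧ mfderiv I J f x v = w

/-- `f` has maximal rank: its derivative is surjective at every point. -/
def HasMaximalRank (f : M → B) : Prop :=
  ∀ x : M, Function.Surjective (mfderiv I J f x)

end HorizontalLift

end

/-!
The inclusion of a fiber preserves distances, so the point is that every `x : M` lies within a fixed
distance of the fiber over `b`. Horizontal lifts depend linearly on the vector lifted, hence the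
affine bound `‖v‖ ≤ α * ‖w‖ + β` improves to `‖v‖ ≤ α * ‖w‖` (`IsHorizontalLift.norm_le`). One could
then lift horizontally a short path from `f x` to `b`; instead of solving this differential
equation, the proof uses only its first order information.

* If `y` is not in the fiber over `b`, take a point `p` near `f y` on an almost shortest path from
  `f y` to `b`, and displace `y` in a chart by a lift of the displacement from `f y` to `p`. To
  first order this brings `f y` to `p`, so it decreases the distance from `f y` to `b` by at least
  a fixed multiple of the displacement of `y` (`exists_edist_add_le_of_lift_bound`). For the
  multiple to be the same at all points, distances near a point are compared, with a constant that
  may be any number greater than `1`, to the norm of the tangent space at that point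
  (`eventually_riemannianEDist_le_enorm_chartVector`,
  `eventually_enorm_chartVector_le_riemannianEDist`).
* As `M` is complete, Ekeland's variational principle turns this local decrease into a point of the
  fiber over `b` at distance at most `8 * α * d (f x, b)` from `x`
  (`exists_eq_zero_edist_le_of_forall_descent`, `exists_eq_edist_le_of_lift_bound`).

Since `B` is compact and connected, `d (f x, b)` is bounded. Moving every point of `M` to a nearby
point of the fiber then gives the rough isometry from `M` to the slice `F_b × {b}`, which is full in
`F_b × B`.
-/

noncomputable section

open Filter Set MeasureTheory
open scoped Topology

/-! ### Rough isometries onto a full subset and its product with a bounded space -/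

section Rough

variable {X Y : Type*} [PseudoEMetricSpace X] [PseudoEMetricSpace Y]

theorem isRoughIsometry_subtype_val {s : Set X} {R : ℝ≥0} (hs : ∀ x, ∃ z ∈ s, edist x z ≤ R) :
    IsRoughIsometry (Subtype.val : s → X) where
  coarse := ⟨1, 0, le_rfl, fun p q => by simp [Subtype.edist_eq]⟩
  full := by
    refine ⟨R + 1, by positivity, eq_univ_of_forall fun x => ?_⟩
    obtain ⟨z, hz, hxz⟩ := hs x
    rw [Metric.mem_thickening_iff_exists_edist_lt]
    refine ⟨z, ⟨⟨z, hz⟩, rfl⟩, hxz.trans_lt ?_⟩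
    rw [ENNReal.ofReal_add R.coe_nonneg zero_le_one, ENNReal.ofReal_coe_nnreal, ENNReal.ofReal_one]
    exact ENNReal.lt_add_right ENNReal.coe_ne_top one_ne_zero

theorem edist_toLp_two_same_right (a a' : X) (b : Y) :
    edist (WithLp.toLp 2 (a, b)) (WithLp.toLp 2 (a', b)) = edist a a' := by
  rw [WithLp.prod_edist_eq_add (by norm_num)]
  simpa using ENNReal.rpow_rpow_inv (two_ne_zero (α := ℝ)) (edist a a')

theorem edist_toLp_two_le_add (a a' : X) (b b' : Y) :
    edist (WithLp.toLp 2 (a, b)) (WithLp.toLp 2 (a', b')) ≤ edist a a' + edist b b' := by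
  rw [WithLp.prod_edist_eq_add (by norm_num)]
  have := ENNReal.rpow_add_rpow_le_add (edist a a') (edist b b') (p := 2) (by norm_num)
  simpa using this

/-- Moving each point to a nearby point of `s` is a rough isometry from `X` to the slice
`s × {b}` of `s × Y`. -/
theorem roughlyIsometric_withLp_prod {s : Set X} {R : ℝ≥0} (hs : ∀ x, ∃ z ∈ s, edist x z ≤ R)
    {b : Y} {D : ℝ≥0} (hb : ∀ y : Y, edist y b ≤ D) : RoughlyIsometric X (WithLp 2 (s × Y)) := by
  choose g hgs hg using hs
  refine ⟨fun x => WithLp.toLp 2 (⟨g x, hgs x⟩, b), ⟨⟨1, 2 * R, le_rfl, fun p q => ?_⟩,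
    R + D + 1, by positivity, eq_univ_of_forall fun w => ?_⟩⟩
  · rw [edist_toLp_two_same_right, Subtype.edist_eq]
    have hp := hg p
    have hq := hg q
    constructor
    · rw [tsub_le_iff_right]
      calc edist p q / (1 : ℝ≥0) = edist p q := by simp
        _ ≤ edist p (g p) + edist (g p) (g q) + edist (g q) q := edist_triangle4 _ _ _ _
        _ ≤ R + edist (g p) (g q) + R := by rw [edist_comm (g q)]; gcongr
        _ = edist (g p) (g q) + (2 * R : ℝ≥0) := by push_cast; ring
    · calc edist (g p) (g q) ≤ edist (g p) p + edist p q + edist q (g q) := edist_triangle4 _ _ _ _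
        _ ≤ R + edist p q + R := by rw [edist_comm (g p)]; gcongr
        _ = (1 : ℝ≥0) * edist p q + (2 * R : ℝ≥0) := by push_cast; ring
  · rw [Metric.mem_thickening_iff_exists_edist_lt]
    refine ⟨_, ⟨w.fst, rfl⟩, (edist_toLp_two_le_add w.fst _ w.snd b).trans_lt ?_⟩
    rw [ENNReal.ofReal_add (by positivity) zero_le_one,
      ENNReal.ofReal_add R.coe_nonneg D.coe_nonneg, ENNReal.ofReal_coe_nnreal,
      ENNReal.ofReal_coe_nnreal, ENNReal.ofReal_one]
    exact (add_le_add (hg w.fst) (hb w.snd)).trans_lt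
      (ENNReal.lt_add_right (by finiteness) one_ne_zero)

end Rough

/-! ### Ekeland's principle and bounded distances -/

section Descent

variable {X : Type*} [EMetricSpace X] [CompleteSpace X]

/-- A form of Ekeland's variational principle. If every point where the continuous function `φ`
does not vanish can be moved so that `φ` decreases by at least the displacement, then starting from
any point `x` with `φ x` finite one reaches a zero of `φ` within distance `φ x`. -/
theorem exists_eq_zero_edist_le_of_forall_descent {φ : X → ℝ≥0∞} (hφ : Continuous φ)
    (hdesc : ∀ y, φ y ≠ 0 → φ y ≠ ⊤ → ∃ y', y' ≠ y ∧ edist y y' + φ y' ≤ φ y)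
    {x : X} (hx : φ x ≠ ⊤) : ∃ z, φ z = 0 ∧ edist x z ≤ φ x := by
  let S : X → Set X := fun y => {y' | edist y y' + φ y' ≤ φ y}
  have hself (y : X) : y ∈ S y := by simp [S]
  have htrans {a b c : X} (hab : b ∈ S a) (hbc : c ∈ S b) : c ∈ S a :=
    calc edist a c + φ c ≤ edist a b + (edist b c + φ c) := by
          rw [← add_assoc]; gcongr; exact edist_triangle _ _ _
      _ ≤ edist a b + φ b := by gcongr; exact hbc
      _ ≤ φ a := hab
  have hle {a b : X} (h : b ∈ S a) : φ b ≤ φ a := le_add_self.trans h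
  have hclosed (y : X) : IsClosed (S y) :=
    isClosed_le ((continuous_const.edist continuous_id).add hφ) continuous_const
  have hfin {y : X} (hy : y ∈ S x) : φ y ≠ ⊤ := ((hle hy).trans_lt hx.lt_top).ne
  -- `S y` is the set of points to which the descent condition allows a move from `y`. Almost
  -- minimizing `φ` on `S (u n)` to get `u (n + 1)` forces the radius of `S (u (n + 1))` to tend
  -- to zero, so the limit admits no further move.
  have hstep (n : ℕ) (y : X) : ∃ w ∈ S y, φ y ≠ ⊤ → ∀ y' ∈ S y, φ w ≤ φ y' + (n : ℝ≥0∞)⁻¹ := by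
    by_cases hy : φ y = ⊤
    · exact ⟨y, hself y, fun h => (h hy).elim⟩
    have hi : (⨅ y' ∈ S y, φ y') ≠ ⊤ := ((iInf₂_le y (hself y)).trans_lt (Ne.lt_top hy)).ne
    have hlt : (⨅ y' ∈ S y, φ y') < (⨅ y' ∈ S y, φ y') + (n : ℝ≥0∞)⁻¹ :=
      ENNReal.lt_add_right hi (by simp)
    simp only [iInf_lt_iff] at hlt
    obtain ⟨w, hw, hwlt⟩ := hlt
    exact ⟨w, hw, fun _ y' hy' => hwlt.le.trans (by gcongr; exact iInf₂_le y' hy')⟩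
  choose g hgS hg using hstep
  let u : ℕ → X := fun n => Nat.rec x (fun n y => g n y) n
  have hmono (n m : ℕ) (h : n ≤ m) : u m ∈ S (u n) := by
    induction m, h using Nat.le_induction with
    | base => exact hself _
    | succ m _ ih => exact htrans ih (hgS _ _)
  have hux (n : ℕ) : u n ∈ S x := hmono 0 n n.zero_le
  have hnear (n : ℕ) {y : X} (hy : y ∈ S (u (n + 1))) : edist (u (n + 1)) y ≤ (n : ℝ≥0∞)⁻¹ := by
    have hyx : φ y ≠ ⊤ := hfin (htrans (hux (n + 1)) hy)
    have h1 : edist (u (n + 1)) y + φ y ≤ φ (u (n + 1)) := hy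
    have h2 : φ (u (n + 1)) ≤ φ y + (n : ℝ≥0∞)⁻¹ :=
      hg n (u n) (hfin (hux n)) y (htrans (hgS _ _) hy)
    rw [add_comm (φ y)] at h2
    exact (ENNReal.add_le_add_iff_right hyx).1 (h1.trans h2)
  have hcauchy : CauchySeq u := by
    rw [EMetric.cauchySeq_iff']
    intro ε hε
    obtain ⟨n, hn⟩ := ENNReal.exists_inv_nat_lt hε.ne'
    exact ⟨n + 1, fun m hm => by
      rw [edist_comm]; exact (hnear n (hmono _ _ hm)).trans_lt hn⟩
  obtain ⟨z, hz⟩ := cauchySeq_tendsto_of_complete hcauchy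
  have hzS (n : ℕ) : z ∈ S (u n) :=
    (hclosed _).mem_of_tendsto hz (eventually_atTop.2 ⟨n, fun m hm => hmono n m hm⟩)
  have hzx : z ∈ S x := hzS 0
  refine ⟨z, ?_, le_self_add.trans hzx⟩
  by_contra h0
  obtain ⟨y', hne, hy'⟩ := hdesc z h0 (hfin hzx)
  refine hne (tendsto_nhds_unique (f := fun n => u (n + 1)) (l := atTop) ?_
    (hz.comp (tendsto_add_atTop_nat 1)))
  rw [tendsto_iff_edist_tendsto_0]
  exact tendsto_of_tendsto_of_tendsto_of_le_of_le tendsto_const_nhds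
    ENNReal.tendsto_inv_nat_nhds_zero (fun _ => zero_le)
    (fun n => hnear n (htrans (hzS (n + 1)) hy'))

end Descent

section Compact

theorem exists_edist_le_of_compactSpace_of_preconnectedSpace (X : Type*) [PseudoEMetricSpace X]
    [CompactSpace X] [PreconnectedSpace X] (b : X) :
    ∃ D : ℝ≥0, ∀ y : X, edist y b ≤ D := by
  have huniv : Metric.eball b ⊤ = univ :=
    IsClopen.eq_univ ⟨Metric.isClosed_eball_top, Metric.isOpen_eball⟩ ⟨b, by simp⟩
  obtain ⟨z, -, hz⟩ := isCompact_univ.exists_isMaxOn (f := fun y : X => edist y b) ⟨b, mem_univ b⟩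
    (continuous_id.edist continuous_const).continuousOn
  have hz' : edist z b < ⊤ := by
    have : z ∈ Metric.eball b ⊤ := huniv ▸ mem_univ z
    simpa using this
  lift edist z b to ℝ≥0 using hz'.ne with D hD
  exact ⟨D, fun y => by rw [hD]; exact hz (mem_univ y)⟩

end Compact

/-! ### Riemannian distance in a chart -/

theorem enorm_le_of_norm_le_mul {F G : Type*} [SeminormedAddGroup F] [SeminormedAddGroup G]
    {a : F} {b : G} {r : ℝ≥0} (h : ‖a‖ ≤ r * ‖b‖) : ‖a‖ₑ ≤ r * ‖b‖ₑ := by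
  rw [enorm_eq_nnnorm, enorm_eq_nnnorm]
  exact_mod_cast h

theorem isContinuousRiemannianBundle_of_isContMDiffRiemannianBundle
    {EB HB B : Type*} [NormedAddCommGroup EB] [NormedSpace ℝ EB] [TopologicalSpace HB]
    (IB : ModelWithCorners ℝ EB HB) (n : ℕ∞ω) [TopologicalSpace B] [ChartedSpace HB B]
    (F : Type*) [NormedAddCommGroup F] [NormedSpace ℝ F] (V : B → Type*)
    [TopologicalSpace (TotalSpace F V)] [∀ b, NormedAddCommGroup (V b)]
    [∀ b, InnerProductSpace ℝ (V b)] [FiberBundle F V] [VectorBundle ℝ F V]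
    [h : IsContMDiffRiemannianBundle IB n F V] : IsContinuousRiemannianBundle F V := by
  obtain ⟨g, hg, hgV⟩ := h.exists_contMDiff
  exact ⟨g, hg.continuous, hgV⟩

section Charts

variable {E H : Type*} [NormedAddCommGroup E] [NormedSpace ℝ E] [TopologicalSpace H]
  (I : ModelWithCorners ℝ E H) {M : Type*} [TopologicalSpace M] [ChartedSpace H M]
  [IsManifold I 1 M]

/-- The tangent vector at `x` with coordinates `u` in the extended chart at `x`. Spelling out this
identification of the model space with `TangentSpace I x` keeps the norm of the model space apart
from the norm given by a Riemannian metric. -/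
def chartVector (x : M) : E →L[ℝ] TangentSpace I x :=
  (trivializationAt E (TangentSpace I) x).symmL ℝ x

/-- The coordinates of a tangent vector at `x` in the extended chart at `x`. -/
def chartCoord (x : M) : TangentSpace I x →L[ℝ] E :=
  (trivializationAt E (TangentSpace I) x).continuousLinearMapAt ℝ x

@[simp]
theorem chartCoord_chartVector (x : M) (u : E) : chartCoord I x (chartVector I x u) = u :=
  (trivializationAt E (TangentSpace I) x).continuousLinearMapAt_symmL
    (FiberBundle.mem_baseSet_trivializationAt' x) u

@[simp]
theorem chartVector_chartCoord (x : M) (v : TangentSpace I x) :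
    chartVector I x (chartCoord I x v) = v :=
  (trivializationAt E (TangentSpace I) x).symmL_continuousLinearMapAt
    (FiberBundle.mem_baseSet_trivializationAt' x) v

variable [RiemannianBundle (fun x : M => TangentSpace I x)]
  [IsContinuousRiemannianBundle E (fun x : M => TangentSpace I x)]

/-- Near the center, the inverse of the extended chart at `x` stretches by at most `r > 1` the norm
which the chart carries over from `T_x M`. -/
theorem eventually_enorm_mfderivWithin_extChartAt_symm_le (x : M) {r : ℝ≥0} (hr : 1 < r) :
    ∀ᶠ y in 𝓝[range I] (extChartAt I x x), ∀ u : E,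
      ‖mfderivWithin 𝓘(ℝ, E) I (extChartAt I x).symm (range I) y u‖ₑ
        ≤ r * ‖chartVector I x u‖ₑ := by
  have h := (eventually_norm_symmL_trivializationAt_comp_self_lt E
    (fun x : M => TangentSpace I x) x (r := r) (by exact_mod_cast hr)).and
    (chart_source_mem_nhds H x)
  have hc : Tendsto (extChartAt I x).symm (𝓝[range I] (extChartAt I x x)) (𝓝 x) := by
    have := (continuousAt_extChartAt_symm (I := I) x).tendsto
    rw [extChartAt_to_inv] at this
    exact this.mono_left nhdsWithin_le_nhds
  filter_upwards [hc.eventually h, extChartAt_target_mem_nhdsWithin x] with y hy hyt u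
  have h1 := ContinuousLinearMap.le_of_opNorm_le _ hy.1.le (chartVector I x u)
  have h2 : (trivializationAt E (TangentSpace I) x).continuousLinearMapAt ℝ x
      (chartVector I x u) = u := chartCoord_chartVector I x u
  rw [ContinuousLinearMap.comp_apply, h2, TangentBundle.symmL_trivializationAt hy.2,
    (extChartAt I x).right_inv hyt] at h1
  exact enorm_le_of_norm_le_mul h1

/-- Near `x`, the extended chart at `x` stretches by at most `r > 1`, when the model space carries
the norm of `T_x M`. -/
theorem eventually_enorm_chartVector_mfderiv_extChartAt_le (x : M) {r : ℝ≥0} (hr : 1 < r) :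
    ∀ᶠ y in 𝓝 x, ∀ v : TangentSpace I y,
      ‖chartVector I x (mfderiv I 𝓘(ℝ, E) (extChartAt I x) y v)‖ₑ ≤ r * ‖v‖ₑ := by
  filter_upwards [eventually_norm_symmL_trivializationAt_self_comp_lt E
    (fun x : M => TangentSpace I x) x (r := r) (by exact_mod_cast hr),
    chart_source_mem_nhds H x] with y hy hys v
  have h1 := ContinuousLinearMap.le_of_opNorm_le _ hy.le v
  rw [ContinuousLinearMap.comp_apply, TangentBundle.continuousLinearMapAt_trivializationAt hys]
    at h1
  exact enorm_le_of_norm_le_mul h1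

/-- Near `x`, the Riemannian distance is at most `r > 1` times the distance in the chart at `x`,
the latter being measured with the inner product of `T_x M`. -/
theorem eventually_riemannianEDist_le_enorm_chartVector (x : M) {r : ℝ≥0} (hr : 1 < r) :
    ∀ᶠ p : M × M in 𝓝 x ×ˢ 𝓝 x, riemannianEDist I p.1 p.2 ≤
      r * ‖chartVector I x (extChartAt I x p.2 - extChartAt I x p.1)‖ₑ := by
  obtain ⟨ρ, ρ_pos, hρ⟩ := Metric.mem_nhdsWithin_iff.1
    (inter_mem (extChartAt_target_mem_nhdsWithin x)
      (eventually_enorm_mfderivWithin_extChartAt_symm_le I x hr))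
  have A : (extChartAt I x) ⁻¹' (Metric.ball (extChartAt I x x) ρ ∩ range I) ∈ 𝓝 x := by
    apply extChartAt_preimage_mem_nhds_of_mem_nhdsWithin (by simp)
    rw [inter_comm]
    exact inter_mem_nhdsWithin _ (Metric.ball_mem_nhds _ ρ_pos)
  have A' := inter_mem A (chart_source_mem_nhds H x)
  filter_upwards [prod_mem_prod A' A']
  rintro ⟨p, q⟩ ⟨⟨hp, hp'⟩, ⟨hq, hq'⟩⟩
  -- `η` is the segment between the two points in the chart; by convexity it does not leave the
  -- ball where the derivative of the inverse chart is controlled.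
  let η := ContinuousAffineMap.lineMap (R := ℝ) (extChartAt I x p) (extChartAt I x q)
  have hη : Icc 0 1 ⊆ ⇑η ⁻¹' ((extChartAt I x).target ∩ {y | ∀ u : E,
      ‖mfderivWithin 𝓘(ℝ, E) I (extChartAt I x).symm (range I) y u‖ₑ
        ≤ r * ‖chartVector I x u‖ₑ}) := by
    simp only [← image_subset_iff, ContinuousAffineMap.coe_lineMap_eq,
     ← segment_eq_image_lineMap, η]
    exact (((convex_ball _ _).inter I.convex_range).segment_subset hp hq).trans hρ
  simp only [preimage_inter, subset_inter_iff] at hη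
  have η_smooth : CMDiff[Icc 0 1] 1 η := by
    apply ContMDiff.contMDiffOn
    rw [contMDiff_iff_contDiff]
    exact ContinuousAffineMap.contDiff _
  have : riemannianEDist I p q ≤ pathELength I ((extChartAt I x).symm ∘ η) 0 1 := by
    apply riemannianEDist_le_pathELength _ _ _ zero_le_one
    · exact (contMDiffOn_extChartAt_symm x).comp η_smooth hη.1
    · simp [η, ContinuousAffineMap.coe_lineMap_eq, hp']
    · simp [η, ContinuousAffineMap.coe_lineMap_eq, hq']
  apply this.trans
  rw [pathELength_eq_lintegral_mfderivWithin_Icc]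
  have key : ∀ t ∈ Icc (0 : ℝ) 1, ‖mfderiv[Icc 0 1] ((extChartAt I x).symm ∘ η) t 1‖ₑ ≤
      r * ‖chartVector I x (extChartAt I x q - extChartAt I x p)‖ₑ := by
    intro t ht
    have hu : UniqueDiffWithinAt ℝ (Icc (0 : ℝ) 1) t := uniqueDiffOn_Icc zero_lt_one t ht
    have h1 : mfderiv[Icc 0 1] ((extChartAt I x).symm ∘ η) t =
        (mfderiv[range I] (extChartAt I x).symm (η t)) ∘L (mfderiv[Icc 0 1] η t) := by
      apply mfderivWithin_comp
      · exact mdifferentiableWithinAt_extChartAt_symm (hη.1 ht)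
      · exact η_smooth.mdifferentiableOn one_ne_zero t ht
      · exact hη.1.trans (preimage_mono (extChartAt_target_subset_range x))
      · rwa [uniqueMDiffWithinAt_iff_uniqueDiffWithinAt]
    have h2 : mfderiv[Icc 0 1] ((extChartAt I x).symm ∘ η) t 1 =
        (mfderiv[range I] (extChartAt I x).symm (η t)) (mfderiv[Icc 0 1] η t 1) :=
      congr($h1 1)
    have hd (a b : E) :
        fderiv ℝ (ContinuousAffineMap.lineMap (R := ℝ) a b) t 1 = b - a := by simp
    have h3 : mfderiv[Icc 0 1] η t 1 = extChartAt I x q - extChartAt I x p := by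
      rw [mfderivWithin_eq_fderivWithin,
        fderivWithin_eq_fderiv hu (ContinuousAffineMap.differentiableAt _)]
      exact hd _ _
    rw [h2, h3]
    exact hη.2 ht _
  calc _ ≤ ∫⁻ t in Icc (0 : ℝ) 1,
        r * ‖chartVector I x (extChartAt I x q - extChartAt I x p)‖ₑ :=
        setLIntegral_mono' measurableSet_Icc key
    _ = _ := by simp

/-- Near `x`, the distance in the chart at `x`, measured with the inner product of `T_x M`, is at
most `r > 1` times the Riemannian distance to `x`. -/
theorem eventually_enorm_chartVector_le_riemannianEDist [RegularSpace M] (x : M) {r : ℝ≥0}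
    (hr : 1 < r) :
    ∀ᶠ y in 𝓝 x, ‖chartVector I x (extChartAt I x y - extChartAt I x x)‖ₑ ≤
      r * riemannianEDist I x y := by
  obtain ⟨c, c_pos, hc⟩ := setOfPred_riemannianEDist_lt_subset_nhds' I
    (inter_mem (chart_source_mem_nhds H x)
      (eventually_enorm_chartVector_mfderiv_extChartAt_le I x hr))
  filter_upwards [eventually_riemannianEDist_lt I x c_pos] with y hy
  have hr0 : (r : ℝ≥0∞) ≠ 0 := by exact_mod_cast (zero_lt_one.trans hr).ne'
  rw [mul_comm, ← ENNReal.div_le_iff_le_mul (.inl hr0) (.inl ENNReal.coe_ne_top)]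
  -- A path from `x` of length less than `c` stays in the good neighborhood of `x`.
  refine le_of_forall_gt_imp_ge_of_dense fun b hb => ?_
  obtain ⟨γ, hγ0, hγ1, hγ, hγb⟩ := exists_lt_of_riemannianEDist_lt (lt_min hb hy)
  have hmem : ∀ t ∈ Icc (0 : ℝ) 1, γ t ∈ (chartAt H x).source ∩ {y | ∀ v : TangentSpace I y,
      ‖chartVector I x (mfderiv I 𝓘(ℝ, E) (extChartAt I x) y v)‖ₑ ≤ r * ‖v‖ₑ} := fun t ht =>
    hc <| calc riemannianEDist I x (γ t)
      _ ≤ pathELength I γ 0 t :=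
        riemannianEDist_le_pathELength (hγ.mono (Icc_subset_Icc_right ht.2)) hγ0 rfl ht.1
      _ ≤ pathELength I γ 0 1 := pathELength_mono le_rfl ht.2
      _ < c := hγb.trans_le (min_le_right _ _)
  have hγ' : ContDiffOn ℝ 1 (extChartAt I x ∘ γ) (Icc 0 1) := by
    rw [← contMDiffOn_iff_contDiffOn]
    exact contMDiffOn_extChartAt.comp (I' := I) (t := (chartAt H x).source) hγ
      fun t ht => (hmem t ht).1
  have hlen := enorm_sub_le_lintegral_derivWithin_Icc_of_contDiffOn_Icc
    ((chartVector I x).contDiff.comp_contDiffOn hγ') zero_le_one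
  have key : ∀ t ∈ Icc (0 : ℝ) 1,
      ‖derivWithin (chartVector I x ∘ extChartAt I x ∘ γ) (Icc 0 1) t‖ₑ ≤
        r * ‖mfderiv[Icc 0 1] γ t 1‖ₑ := by
    intro t ht
    have hu : UniqueDiffWithinAt ℝ (Icc (0 : ℝ) 1) t := uniqueDiffOn_Icc zero_lt_one t ht
    have h1 : mfderiv[Icc 0 1] (extChartAt I x ∘ γ) t =
        (mfderiv% (extChartAt I x) (γ t)) ∘L (mfderiv[Icc 0 1] γ t) := by
      apply mfderiv_comp_mfderivWithin
      · exact mdifferentiableAt_extChartAt (hmem t ht).1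
      · exact hγ.mdifferentiableOn one_ne_zero t ht
      · rwa [uniqueMDiffWithinAt_iff_uniqueDiffWithinAt]
    have h2 : mfderiv[Icc 0 1] (extChartAt I x ∘ γ) t 1 =
        (mfderiv% (extChartAt I x) (γ t)) (mfderiv[Icc 0 1] γ t 1) := congr($h1 1)
    have h3 : derivWithin (chartVector I x ∘ extChartAt I x ∘ γ) (Icc 0 1) t =
        chartVector I x (mfderiv[Icc 0 1] (extChartAt I x ∘ γ) t 1) := by
      rw [mfderivWithin_eq_fderivWithin]
      exact ((chartVector I x).hasFDerivAt.comp_hasDerivWithinAt t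
        (hγ'.differentiableOn one_ne_zero t ht).hasDerivWithinAt).derivWithin hu
    rw [h3, h2]
    exact (hmem t ht).2 _
  have hfin : ‖chartVector I x (extChartAt I x y - extChartAt I x x)‖ₑ ≤
      r * pathELength I γ 0 1 := by
    rw [pathELength_eq_lintegral_mfderivWithin_Icc, ← lintegral_const_mul' _ _ ENNReal.coe_ne_top,
      map_sub]
    simp only [Function.comp_apply, hγ0, hγ1] at hlen
    exact hlen.trans (setLIntegral_mono' measurableSet_Icc key)
  rw [ENNReal.div_le_iff_le_mul (.inl hr0) (.inl ENNReal.coe_ne_top), mul_comm]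
  exact hfin.trans (by gcongr; exact (hγb.trans_le (min_le_left _ _)).le)

end Charts

/-! ### Lifts of tangent vectors and distance to a fiber -/

section Lifts

variable {E H E' H' : Type*} [NormedAddCommGroup E] [NormedSpace ℝ E] [TopologicalSpace H]
  [NormedAddCommGroup E'] [NormedSpace ℝ E'] [TopologicalSpace H']
  {I : ModelWithCorners ℝ E H} {J : ModelWithCorners ℝ E' H'}
  {M B : Type*}

section Topological

variable [TopologicalSpace M] [ChartedSpace H M] [IsManifold I 1 M]
  [TopologicalSpace B] [ChartedSpace H' B] [IsManifold J 1 B]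

theorem chartVector_apply (x : M) (u : E) : chartVector I x u = (show TangentSpace I x from u) := by
  rw [chartVector, TangentBundle.symmL_trivializationAt_eq_core (mem_chart_source H x)]
  exact (tangentBundleCore I M).coordChange_self _ x (mem_achart_source H x) u

theorem chartCoord_apply (x : M) (v : TangentSpace I x) : chartCoord I x v = (show E from v) := by
  rw [chartCoord, TangentBundle.continuousLinearMapAt_trivializationAt_eq_core
    (mem_chart_source H x)]
  exact (tangentBundleCore I M).coordChange_self _ x (mem_achart_source H x) v

/-- The derivative of `f` in the charts at `x` and `f x` is the manifold derivative, conjugated by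
the identifications of the tangent spaces with the model spaces. -/
theorem hasFDerivAt_writtenInExtChartAt [I.Boundaryless] {f : M → B} {x : M}
    (hf : MDifferentiableAt I J f x) :
    HasFDerivAt (writtenInExtChartAt I J x f)
      (chartCoord J (f x) ∘L mfderiv I J f x ∘L chartVector I x) (extChartAt I x x) := by
  have e : (chartCoord J (f x) ∘L mfderiv I J f x ∘L chartVector I x) =
      (show E →L[ℝ] E' from mfderiv I J f x) := by
    ext u
    rw [ContinuousLinearMap.comp_apply, ContinuousLinearMap.comp_apply, chartCoord_apply,
      chartVector_apply]
    rfl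
  rw [e, ← hasFDerivWithinAt_univ, ← I.range_eq_univ]
  exact hf.hasMFDerivAt.2

variable [RiemannianBundle (fun x : M => TangentSpace I x)]
  [IsContinuousRiemannianBundle E (fun x : M => TangentSpace I x)]
  [RiemannianBundle (fun b : B => TangentSpace J b)]
  [IsContinuousRiemannianBundle E' (fun b : B => TangentSpace J b)]

/-- Suppose every tangent vector `w` at `f y` has a lift at `y` of norm at most `K * ‖w‖`. Then
every point `p` close to `f y` is the image of a point at distance at most `4 * K * d (f y) p` from
`y`, up to an error which is small compared to `d (f y) p`: displace `y`, in a chart, by a lift of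
the displacement from `f y` to `p`. -/
theorem eventually_exists_riemannianEDist_le [RegularSpace B] [I.Boundaryless] {f : M → B} {y : M}
    (hf : MDifferentiableAt I J f y) {K : ℝ≥0}
    (hK : ∀ w : TangentSpace J (f y), ∃ v : TangentSpace I y,
      mfderiv I J f y v = w ∧ ‖v‖ ≤ K * ‖w‖) {ε : ℝ≥0} (hε : 0 < ε) :
    ∀ᶠ p in 𝓝 (f y), ∃ y', riemannianEDist I y y' ≤ 4 * K * riemannianEDist J (f y) p ∧
      riemannianEDist J p (f y') ≤ ε * riemannianEDist J (f y) p := by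
  choose V hV hVK using hK
  let u : B → TangentSpace J (f y) := fun p =>
    chartVector J (f y) (extChartAt J (f y) p - extChartAt J (f y) (f y))
  let z : B → E := fun p => chartCoord I y (V (u p))
  let g : B → M := fun p => (extChartAt I y).symm (extChartAt I y y + z p)
  have hu : Tendsto u (𝓝 (f y)) (𝓝 0) := by
    have h : ContinuousAt u (f y) := (chartVector J (f y)).continuous.continuousAt.comp
      ((continuousAt_extChartAt (f y)).sub continuousAt_const)
    simpa [ContinuousAt, u] using h
  have hVu : (fun p => V (u p)) =O[𝓝 (f y)] u :=
    Asymptotics.IsBigO.of_bound K (Eventually.of_forall fun p => hVK _)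
  have hzu : z =O[𝓝 (f y)] u := ((chartCoord I y).isBigO_comp _ _).trans hVu
  have hz : Tendsto z (𝓝 (f y)) (𝓝 0) := hzu.trans_tendsto hu
  have hadd : Tendsto (fun p => extChartAt I y y + z p) (𝓝 (f y)) (𝓝 (extChartAt I y y)) := by
    simpa using tendsto_const_nhds.add hz
  have hg : Tendsto g (𝓝 (f y)) (𝓝 y) := by
    have h := (continuousAt_extChartAt_symm (I := I) y).tendsto.comp hadd
    rwa [extChartAt_to_inv] at h
  -- The displacement `z p` is mapped by the derivative of `f` to the displacement from `f y` to
  -- `p`, so that `f (g p)` and `p` agree to first order.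
  have hlo : (fun p => chartVector J (f y) (extChartAt J (f y) (f (g p)) - extChartAt J (f y) p))
      =o[𝓝 (f y)] u := by
    refine ((chartVector J (f y)).isBigO_comp _ _).trans_isLittleO (.trans_isBigO ?_ hzu)
    refine ((hasFDerivAt_writtenInExtChartAt hf).isLittleO.comp_tendsto hadd).congr
      (fun p => ?_) (fun p => ?_)
    · have h0 : (extChartAt I y).symm (extChartAt I y y) = y := extChartAt_to_inv y
      simp [-extChartAt, -map_sub, z, u, g, hV, writtenInExtChartAt, h0]
    · simp
  filter_upwards [hadd.eventually (extChartAt_target_mem_nhds y),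
    (tendsto_const_nhds.prodMk hg).eventually
      (eventually_riemannianEDist_le_enorm_chartVector I y one_lt_two),
    (tendsto_id.prodMk (hf.continuousAt.tendsto.comp hg)).eventually
      (eventually_riemannianEDist_le_enorm_chartVector J (f y) one_lt_two),
    eventually_enorm_chartVector_le_riemannianEDist J (f y) one_lt_two,
    hlo.bound (c := ε / 4) (by positivity)] with p hp h1 h2 h3 h4
  refine ⟨g p, ?_, ?_⟩
  · have h5 : extChartAt I y (g p) - extChartAt I y y = z p := by
      simp only [g]
      rw [(extChartAt I y).right_inv hp, add_sub_cancel_left]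
    have h6 : ‖V (u p)‖ₑ ≤ K * ‖u p‖ₑ := enorm_le_of_norm_le_mul (hVK _)
    calc riemannianEDist I y (g p) ≤ 2 * ‖V (u p)‖ₑ := by
          simpa only [h5, z, chartVector_chartCoord, ENNReal.coe_ofNat] using h1
      _ ≤ 2 * (K * (2 * riemannianEDist J (f y) p)) := by
          gcongr; exact h6.trans (by gcongr; exact h3)
      _ = 4 * K * riemannianEDist J (f y) p := by ring
  · have h6 := enorm_le_of_norm_le_mul (r := ε / 4) (by exact_mod_cast h4)
    calc riemannianEDist J p (f (g p)) ≤ _ := h2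
      _ ≤ 2 * ((ε / 4 : ℝ≥0) * (2 * riemannianEDist J (f y) p)) := by
          gcongr
          · simp
          · exact h6.trans (by gcongr; exact h3)
      _ = ((ε / 4 * 4 : ℝ≥0) : ℝ≥0∞) * riemannianEDist J (f y) p := by push_cast; ring
      _ = ε * riemannianEDist J (f y) p := by rw [div_mul_cancel₀ _ (by norm_num)]

end Topological

section Metric

variable [EMetricSpace B] [ChartedSpace H' B] [RiemannianBundle (fun b : B => TangentSpace J b)]

variable (J) in
/-- On an almost minimizing path from `c` to `b` one finds points at any small distance from `c`
that are almost that much closer to `b`. -/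
theorem exists_edist_eq_edist_add_le [IsRiemannianManifold J B] {c b : B} (hcb : edist c b ≠ ⊤)
    {s δ : ℝ≥0∞} (hs : s ≤ edist c b) (hδ : δ ≠ 0) :
    ∃ p, edist c p = s ∧ edist p b + s ≤ edist c b + δ := by
  have hlt : riemannianEDist J c b < edist c b + δ := by
    rw [← IsRiemannianManifold.out (I := J)]
    exact ENNReal.lt_add_right hcb hδ
  obtain ⟨γ, hγ0, hγ1, hγ, hγl⟩ := exists_lt_of_riemannianEDist_lt hlt
  have hcont : ContinuousOn (fun t => edist c (γ t)) (Icc 0 1) :=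
    (continuous_const.edist continuous_id).comp_continuousOn hγ.continuousOn
  obtain ⟨t, ht, hts⟩ : s ∈ (fun t => edist c (γ t)) '' Icc 0 1 :=
    intermediate_value_Icc zero_le_one hcont (by simp [hγ0, hγ1, hs])
  beta_reduce at hts
  refine ⟨γ t, hts, ?_⟩
  have h1 : edist (γ t) b ≤ pathELength J γ t 1 := by
    rw [IsRiemannianManifold.out (I := J)]
    exact riemannianEDist_le_pathELength (hγ.mono (Icc_subset_Icc_left ht.1)) rfl hγ1 ht.2
  have h2 : s ≤ pathELength J γ 0 t := by
    rw [← hts, IsRiemannianManifold.out (I := J)]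
    exact riemannianEDist_le_pathELength (hγ.mono (Icc_subset_Icc_right ht.2)) hγ0 rfl ht.1
  calc edist (γ t) b + s ≤ pathELength J γ t 1 + pathELength J γ 0 t := add_le_add h1 h2
    _ = pathELength J γ 0 1 := by rw [add_comm, pathELength_add ht.1 ht.2]
    _ ≤ edist c b + δ := hγl.le

variable [IsRiemannianManifold J B] [IsManifold J 1 B]
  [IsContinuousRiemannianBundle E' (fun b : B => TangentSpace J b)]
  [EMetricSpace M] [ChartedSpace H M] [IsManifold I 1 M]
  [RiemannianBundle (fun x : M => TangentSpace I x)]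
  [IsContinuousRiemannianBundle E (fun x : M => TangentSpace I x)] [IsRiemannianManifold I M]

/-- The descent step: a point `y` off the fiber over `b` can be moved so that the distance of its
image to `b` decreases in proportion to the displacement. The target is a point `p` at a small
distance `4 * q` from `f y` with `d (p, b) ≤ d (f y, b) - 3 * q`; displacing `y` by at most
`16 * K * q` brings `f y` within `q` of `p`, hence closer to `b` by `2 * q`. -/
theorem exists_edist_add_le_of_lift_bound [I.Boundaryless] {f : M → B} {y : M}
    (hf : MDifferentiableAt I J f y) {K : ℝ≥0}
    (hK : ∀ w : TangentSpace J (f y), ∃ v : TangentSpace I y,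
      mfderiv I J f y v = w ∧ ‖v‖ ≤ K * ‖w‖)
    {b : B} (hyb : f y ≠ b) (hfin : edist (f y) b ≠ ⊤) :
    ∃ y', y' ≠ y ∧ edist y y' + 8 * K * edist (f y') b ≤ 8 * K * edist (f y) b := by
  obtain ⟨σ, hσ, hball⟩ := EMetric.mem_nhds_iff.1
    (eventually_exists_riemannianEDist_le hf hK (ε := 1 / 4) (by norm_num))
  obtain ⟨s, hs0, hs⟩ := ENNReal.lt_iff_exists_nnreal_btwn.1
    (lt_min hσ (edist_pos.2 hyb))
  obtain ⟨q, rfl⟩ : ∃ q : ℝ≥0, s = 4 * q := ⟨s / 4, by field_simp⟩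
  have hq : (q : ℝ≥0∞) ≠ 0 := by
    rintro h
    simp [ENNReal.coe_eq_zero.1 h] at hs0
  obtain ⟨p, hcp, hpb⟩ := exists_edist_eq_edist_add_le J hfin
    (hs.le.trans (min_le_right _ _)) hq
  obtain ⟨y', hy', hfy'⟩ := hball (show p ∈ Metric.eball (f y) σ by
    rw [Metric.mem_eball', hcp]; exact hs.trans_le (min_le_left _ _))
  rw [← IsRiemannianManifold.out (I := I), ← IsRiemannianManifold.out (I := J), hcp] at hy'
  rw [← IsRiemannianManifold.out (I := J), ← IsRiemannianManifold.out (I := J), hcp,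
    ← ENNReal.coe_mul, ← mul_assoc, one_div_mul_cancel (by norm_num), one_mul] at hfy'
  have hdec : edist (f y') b + 2 * q ≤ edist (f y) b := by
    refine (ENNReal.add_le_add_iff_right (a := 2 * (q : ℝ≥0∞)) (by finiteness)).1 ?_
    calc edist (f y') b + 2 * q + 2 * q ≤ (edist (f y') p + edist p b) + 2 * q + 2 * q := by
          gcongr; exact edist_triangle _ _ _
      _ = edist (f y') p + (edist p b + (4 * q : ℝ≥0)) := by push_cast; ring
      _ ≤ q + (edist (f y) b + q) := by
          rw [edist_comm]; gcongr
      _ = edist (f y) b + 2 * q := by ring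
  refine ⟨y', ?_, ?_⟩
  · rintro rfl
    exact absurd hdec (not_le.2 (ENNReal.lt_add_right hfin (by simpa using hq)))
  · calc edist y y' + 8 * K * edist (f y') b
        ≤ 4 * K * (4 * q : ℝ≥0) + 8 * K * edist (f y') b := by gcongr
      _ = 8 * K * (edist (f y') b + 2 * q) := by push_cast; ring
      _ ≤ 8 * K * edist (f y) b := by gcongr

/-- If tangent vectors of `B` have lifts of norm at most `K` times their norm, then the distance
from `x` to the fiber over `b` is at most `8 * K` times the distance from `f x` to `b`, provided
that the latter is finite. -/
theorem exists_eq_edist_le_of_lift_bound [CompleteSpace M] [I.Boundaryless] {f : M → B}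
    (hf : MDifferentiable I J f) {K : ℝ≥0} (hK0 : K ≠ 0)
    (hK : ∀ (y : M) (w : TangentSpace J (f y)), ∃ v : TangentSpace I y,
      mfderiv I J f y v = w ∧ ‖v‖ ≤ K * ‖w‖)
    {x : M} {b : B} (hfin : edist (f x) b ≠ ⊤) :
    ∃ z, f z = b ∧ edist x z ≤ 8 * K * edist (f x) b := by
  have hK8 : (8 * K : ℝ≥0∞) ≠ 0 := by simpa using hK0
  obtain ⟨z, hz, hxz⟩ := exists_eq_zero_edist_le_of_forall_descent
    (φ := fun y => 8 * K * edist (f y) b)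
    ((ENNReal.continuous_const_mul (by finiteness)).comp (hf.continuous.edist continuous_const))
    (fun y hy hy' => exists_edist_add_le_of_lift_bound (hf y) (hK y)
      (fun h => hy (by simp [h])) (fun h => hy' (by simp [h, hK0])))
    (x := x) (by finiteness)
  exact ⟨z, by simpa [hK0] using hz, hxz⟩

end Metric

section Horizontal

variable [TopologicalSpace M] [ChartedSpace H M] [TopologicalSpace B] [ChartedSpace H' B]
  [RiemannianBundle (fun x : M => TangentSpace I x)]

theorem IsHorizontalLift.smul {f : M → B} {x : M} {w : TangentSpace J (f x)} {v : TangentSpace I x}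
    (h : IsHorizontalLift I J f x w v) (t : ℝ) : IsHorizontalLift I J f x (t • w) (t • v) :=
  ⟨Submodule.smul_mem _ t h.1, by rw [map_smul, h.2]⟩

theorem exists_isHorizontalLift [FiniteDimensional ℝ E] {f : M → B} {x : M}
    (hf : Function.Surjective (mfderiv I J f x)) (w : TangentSpace J (f x)) :
    ∃ v : TangentSpace I x, IsHorizontalLift I J f x w v := by
  have : FiniteDimensional ℝ (TangentSpace I x) := inferInstanceAs (FiniteDimensional ℝ E)
  obtain ⟨v₀, rfl⟩ := hf w
  obtain ⟨k, hk, v, hv, rfl⟩ :=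
    Submodule.exists_add_mem_mem_orthogonal (K := verticalSpace I J f x) v₀
  have hk' : mfderiv I J f x k = 0 := hk
  exact ⟨v, hv, by rw [map_add, hk', zero_add]⟩

/-- Horizontal lifts are linear, so that an affine bound for their norm is a linear bound. -/
theorem IsHorizontalLift.norm_le [RiemannianBundle (fun b : B => TangentSpace J b)]
    {f : M → B} {x : M} {α β : ℝ}
    (h : ∀ (w : TangentSpace J (f x)) (v : TangentSpace I x),
      IsHorizontalLift I J f x w v → ‖v‖ ≤ α * ‖w‖ + β)
    {w : TangentSpace J (f x)} {v : TangentSpace I x} (hv : IsHorizontalLift I J f x w v) :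
    ‖v‖ ≤ α * ‖w‖ := by
  have key (t : ℝ) (ht : 0 < t) : t * (‖v‖ - α * ‖w‖) ≤ β := by
    have := h _ _ (hv.smul t)
    rw [norm_smul, norm_smul, Real.norm_of_nonneg ht.le] at this
    linarith
  by_contra! hlt
  have hpos : 0 < ‖v‖ - α * ‖w‖ := sub_pos.2 hlt
  have h1 := key ((|β| + 1) / (‖v‖ - α * ‖w‖)) (by positivity)
  rw [div_mul_cancel₀ _ hpos.ne'] at h1
  linarith [le_abs_self β]

end Horizontal

end Lifts

end

/-! ### Fibers of submersions with bounded horizontal lifts -/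

theorem theorem4p2p1 {m n : ℕ}
    -- `M` is a complete smooth Riemannian manifold of dimension `m`
    {M : Type*} [EMetricSpace M] [ChartedSpace (EuclideanSpace ℝ (Fin m)) M]
    [IsManifold (𝓡 m) ∞ M]
    [RiemannianBundle (fun x : M => TangentSpace (𝓡 m) x)]
    [IsContMDiffRiemannianBundle (𝓡 m) ∞ (EuclideanSpace ℝ (Fin m))
      (fun x : M => TangentSpace (𝓡 m) x)]
    [IsRiemannianManifold (𝓡 m) M] [CompleteSpace M]
    -- `B` is a compact connected smooth Riemannian manifold of dimension `n`
    {B : Type*} [EMetricSpace B] [ChartedSpace (EuclideanSpace ℝ (Fin n)) B]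
    [IsManifold (𝓡 n) ∞ B]
    [RiemannianBundle (fun b : B => TangentSpace (𝓡 n) b)]
    [IsContMDiffRiemannianBundle (𝓡 n) ∞ (EuclideanSpace ℝ (Fin n))
      (fun b : B => TangentSpace (𝓡 n) b)]
    [IsRiemannianManifold (𝓡 n) B] [CompactSpace B] [ConnectedSpace B]
    -- `f` is a smooth map of maximal rank from `M` onto `B`
    (f : M → B) (hsmooth : ContMDiff (𝓡 m) (𝓡 n) ∞ f) (honto : Function.Surjective f)
    (hrank : HasMaximalRank (𝓡 m) (𝓡 n) f)
    -- uniform control of the length of horizontal lifts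
    (hlift : ∃ α β : ℝ, 1 ≤ α ∧ 0 < β ∧
      ∀ (x : M) (w : TangentSpace (𝓡 n) (f x)) (v : TangentSpace (𝓡 m) x),
        IsHorizontalLift (𝓡 m) (𝓡 n) f x w v → ‖v‖ ≤ α * ‖w‖ + β) :
    -- fibers carry the restricted distance of `M`, the product carries the `ℓ²` product distance
    ∀ b : B,
      IsRoughIsometry (Subtype.val : (f ⁻¹' {b} : Set M) → M) ∧
      RoughlyIsometric M (WithLp 2 ((f ⁻¹' {b} : Set M) × B)) := by
  have hMc : IsContinuousRiemannianBundle (EuclideanSpace ℝ (Fin m))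
      (fun x : M => TangentSpace (𝓡 m) x) :=
    isContinuousRiemannianBundle_of_isContMDiffRiemannianBundle (𝓡 m) ∞ _ _
  have hBc : IsContinuousRiemannianBundle (EuclideanSpace ℝ (Fin n))
      (fun b : B => TangentSpace (𝓡 n) b) :=
    isContinuousRiemannianBundle_of_isContMDiffRiemannianBundle (𝓡 n) ∞ _ _
  intro b
  obtain ⟨α, β, hα, -, hlift⟩ := hlift
  lift α to ℝ≥0 using zero_le_one.trans hα
  have hα0 : α ≠ 0 := by
    rintro rfl
    norm_num at hα
  have hbound (y : M) (w : TangentSpace (𝓡 n) (f y)) : ∃ v : TangentSpace (𝓡 m) y,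
      mfderiv (𝓡 m) (𝓡 n) f y v = w ∧ ‖v‖ ≤ α * ‖w‖ := by
    obtain ⟨v, hv⟩ := exists_isHorizontalLift (hrank y) w
    exact ⟨v, hv.2, hv.norm_le (hlift y)⟩
  obtain ⟨D, hD⟩ := exists_edist_le_of_compactSpace_of_preconnectedSpace B b
  have hfiber (x : M) : ∃ z ∈ f ⁻¹' {b}, edist x z ≤ (8 * α * D : ℝ≥0) := by
    obtain ⟨z, hz, hxz⟩ := exists_eq_edist_le_of_lift_bound
      (hsmooth.mdifferentiable (by simp)) hα0 hbound
      ((hD (f x)).trans_lt ENNReal.coe_lt_top).ne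
    refine ⟨z, hz, hxz.trans ?_⟩
    push_cast
    gcongr
    exact hD (f x)
  exact ⟨isRoughIsometry_subtype_val hfiber, roughlyIsometric_withLp_prod hfiber hD⟩
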